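/- Let $d\in\mathbb N$ and let $q\in\mathbb R$ with $q>\frac d2+1$. Let $\mathcal F f(\xi)=\int_{\mathbb R^d}e^{-2\pi i\langle x,\xi\rangle}f(x)\,dx$ denote the Fourier transform (extended to $L^2$), and let $$H^q(\mathbb R^d,\mathbb R^d)=\{f\in L^2(\mathbb R^d,\mathbb R^d):\ \|f\|_{H^q}<\infty\},\qquad \|f\|_{H^q}=\big\|(1+|\xi|^2)^{q/2}\,\mathcal F f\big\|_{L^2}.$$ Let $\mathcal D^q(\mathbb R^d)$ be the set of all orientation-preserving $C^1$-diffeomorphisms $\varphi$ of $\mathbb R^d$ with $\varphi-\mathrm{id}\in H^q(\mathbb R^d,\mathbb R^d)$. Give $\mathcal D^q(\mathbb R^d)$ its Hilbert manifold topology, i.e. the topology transported from $H^q(\mathbb R^d,\mathbb R^d)$ by the global chart $\varphi\mapsto\varphi-\mathrm{id}$; this chart is a homeomorphism onto an open subset of $H^q(\mathbb R^d,\mathbb R^d)$. For $\varphi_1,\varphi_2\in\mathcal D^q(\mathbb R^d)$ put $$d_q(\varphi_1,\varphi_2)=\|\varphi_1-\varphi_2\|_{H^q}+\big\|\det(d\varphi_1)^{-1}-\det(d\varphi_2)^{-1}\big\|_\infty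 ,$$ where $\|g\|_\infty=\sup_{x\in\mathbb R^d}|g(x)|$. Then $d_q$ is finite, $(\mathcal D^q(\mathbb R^d),d_q)$ is a complete metric space, and its metric topology coincides with the Hilbert manifold topology of $\mathcal D^q(\mathbb R^d)$. -/

import Mathlib

open MeasureTheory FourierTransform
open scoped Manifold

noncomputable section

namespace SobolevDiffeo

/-- The Euclidean space `ℝᵈ`. -/
abbrev Rd (d : ℕ) : Type := EuclideanSpace ℝ (Fin d)

/-- The Hermitian space `ℂᵈ`. -/
abbrev Cd (d : ℕ) : Type := EuclideanSpace ℂ (Fin d)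

/-- The coordinatewise inclusion `ℝᵈ → ℂᵈ`. -/
def complexify (d : ℕ) : Rd d →L[ℝ] Cd d :=
  LinearMap.toContinuousLinearMap
    { toFun := fun v => WithLp.toLp 2 (fun i => (v i : ℂ))
      map_add' := by intro v w; ext i; simp
      map_smul' := by intro c v; ext i; simp }

theorem complexify_apply (d : ℕ) (v : Rd d) (i : Fin d) : complexify d v i = (v i : ℂ) := rfl

theorem complexify_injective (d : ℕ) : Function.Injective (complexify d) := by
  intro v w h
  ext i
  have := congrArg (fun u : Cd d => u i) h
  simpa [complexify_apply] using this

/-- The Fourier transform `𝓕 f` of `f ∈ L²(ℝᵈ, ℝᵈ)`, an element of `L²(ℝᵈ, ℂᵈ)`; the convention is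
`𝓕 f ξ = ∫ exp (-2πi⟨x, ξ⟩) f x dx`. It is an `ℝ`-linear map. -/
def fourierL2 (d : ℕ) : Lp (Rd d) 2 (volume : Measure (Rd d)) →ₗ[ℝ]
    Lp (Cd d) 2 (volume : Measure (Rd d)) where
  toFun f := 𝓕 ((complexify d).compLp f)
  map_add' f g := by
    rw [← FourierTransform.fourier_add]
    congr 1
    exact map_add ((complexify d).compLpL 2 (volume : Measure (Rd d))) f g
  map_smul' c f := by
    have h1 : (complexify d).compLp (c • f) = (c : ℂ) • (complexify d).compLp f := by
      rw [Complex.coe_smul]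
      exact map_smul ((complexify d).compLpL 2 (volume : Measure (Rd d))) c f
    rw [h1, FourierTransform.fourier_smul, Complex.coe_smul]
    rfl

theorem fourierL2_injective (d : ℕ) : Function.Injective (fourierL2 d) := by
  intro f g h
  have h1 : (complexify d).compLp f = (complexify d).compLp g :=
    (Lp.fourierTransformₗᵢ (Rd d) (Cd d)).injective h
  apply Lp.ext
  filter_upwards [(complexify d).coeFn_compLp f, (complexify d).coeFn_compLp g] with x hf hg
  apply complexify_injective d
  rw [← hf, ← hg, h1]

/-- `(1 + |ξ|²)^(q/2)`. -/
def weight (d : ℕ) (q : ℝ) (ξ : Rd d) : ℝ := (1 + ‖ξ‖ ^ 2) ^ (q / 2)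

theorem weight_pos (d : ℕ) (q : ℝ) (ξ : Rd d) : 0 < weight d q ξ :=
  Real.rpow_pos_of_pos (by positivity) _

/-- The functions `f ∈ L²(ℝᵈ, ℝᵈ)` with `(1 + |ξ|²)^(q/2) 𝓕 f ∈ L²`. -/
def sobolevSubmodule (d : ℕ) (q : ℝ) : Submodule ℝ (Lp (Rd d) 2 (volume : Measure (Rd d))) where
  carrier := {f | MemLp (fun ξ => weight d q ξ • fourierL2 d f ξ) 2 (volume : Measure (Rd d))}
  zero_mem' := by
    refine (memLp_congr_ae ?_).mpr (MemLp.zero (ε := Cd d))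
    rw [map_zero]
    filter_upwards [Lp.coeFn_zero (Cd d) 2 (volume : Measure (Rd d))] with ξ h
    rw [h]
    exact smul_zero _
  add_mem' := by
    intro f g hf hg
    refine (memLp_congr_ae ?_).mpr (MemLp.add hf hg)
    rw [map_add]
    filter_upwards [Lp.coeFn_add (fourierL2 d f) (fourierL2 d g)] with ξ h
    rw [h]
    exact smul_add _ _ _
  smul_mem' := by
    intro c f hf
    refine (memLp_congr_ae ?_).mpr (MemLp.const_smul hf c)
    rw [map_smul]
    filter_upwards [Lp.coeFn_smul c (fourierL2 d f)] with ξ h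
    simp only [h, Pi.smul_apply]
    rw [smul_comm]

theorem memLp_of_mem_sobolevSubmodule {d : ℕ} {q : ℝ}
    {f : Lp (Rd d) 2 (volume : Measure (Rd d))} (hf : f ∈ sobolevSubmodule d q) :
    MemLp (fun ξ => weight d q ξ • fourierL2 d f ξ) 2 (volume : Measure (Rd d)) := hf

/-- The map `f ↦ (1 + |ξ|²)^(q/2) 𝓕 f` with values in `L²(ℝᵈ, ℂᵈ)`. -/
def weightedFourierAux (d : ℕ) (q : ℝ) :
    sobolevSubmodule d q →ₗ[ℝ] Lp (Cd d) 2 (volume : Measure (Rd d)) where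
  toFun f := MemLp.toLp (fun ξ => weight d q ξ • fourierL2 d f.1 ξ)
    (memLp_of_mem_sobolevSubmodule f.2)
  map_add' f g := by
    rw [← MemLp.toLp_add, MemLp.toLp_eq_toLp_iff, Submodule.coe_add, map_add]
    filter_upwards [Lp.coeFn_add (fourierL2 d f.1) (fourierL2 d g.1)] with ξ h
    rw [h]
    exact smul_add _ _ _
  map_smul' c f := by
    rw [RingHom.id_apply, ← MemLp.toLp_const_smul, MemLp.toLp_eq_toLp_iff, Submodule.coe_smul,
      map_smul]
    filter_upwards [Lp.coeFn_smul c (fourierL2 d f.1)] with ξ h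
    rw [h]
    exact smul_comm (weight d q ξ) c (fourierL2 d f.1 ξ)

/-- The Sobolev space `H^q(ℝᵈ, ℝᵈ)`. -/
def Hq (d : ℕ) (q : ℝ) : Type := sobolevSubmodule d q

namespace Hq

variable {d : ℕ} {q : ℝ}

instance : AddCommGroup (Hq d q) := inferInstanceAs (AddCommGroup (sobolevSubmodule d q))

instance : Module ℝ (Hq d q) := inferInstanceAs (Module ℝ (sobolevSubmodule d q))

/-- The map `f ↦ (1 + |ξ|²)^(q/2) 𝓕 f` from `H^q(ℝᵈ, ℝᵈ)` to `L²(ℝᵈ, ℂᵈ)`. -/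
def weightedFourier (d : ℕ) (q : ℝ) : Hq d q →ₗ[ℝ] Lp (Cd d) 2 (volume : Measure (Rd d)) :=
  weightedFourierAux d q

theorem weightedFourier_injective : Function.Injective (weightedFourier d q) := by
  intro f g h
  apply Subtype.ext
  apply fourierL2_injective
  apply Lp.ext
  have h' := (MemLp.toLp_eq_toLp_iff (memLp_of_mem_sobolevSubmodule f.2)
    (memLp_of_mem_sobolevSubmodule g.2)).mp h
  filter_upwards [h'] with ξ hξ
  exact (smul_right_injective _ (weight_pos d q ξ).ne') hξ

/-- The norm `‖f‖_{H^q} = ‖(1 + |ξ|²)^(q/2) 𝓕 f‖_{L²}`. -/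
instance : NormedAddCommGroup (Hq d q) :=
  NormedAddCommGroup.induced (Hq d q) (Lp (Cd d) 2 (volume : Measure (Rd d)))
    (weightedFourier d q) weightedFourier_injective

theorem norm_def (f : Hq d q) : ‖f‖ = ‖weightedFourier d q f‖ := rfl

/-- The norm of `H^q` comes from the inner product
`⟨f, g⟩ = Re ∫ (1 + |ξ|²)^q ⟨𝓕 f, 𝓕 g⟩ dξ`. -/
instance : InnerProductSpace ℝ (Hq d q) where
  norm_smul_le c f := by
    rw [norm_def, norm_def, map_smul]
    exact norm_smul_le c (weightedFourier d q f)
  inner f g := RCLike.re (inner ℂ (weightedFourier d q f) (weightedFourier d q g))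
  norm_sq_eq_re_inner f := by
    rw [norm_def]
    exact norm_sq_eq_re_inner (𝕜 := ℂ) (weightedFourier d q f)
  conj_inner_symm f g := by
    simpa using inner_re_symm (𝕜 := ℂ) (weightedFourier d q g) (weightedFourier d q f)
  add_left f g h := by
    simp [inner_add_left]
  smul_left f g c := by
    have h1 : weightedFourier d q (c • f) = (c : ℂ) • weightedFourier d q f := by
      rw [map_smul]
      rfl
    rw [h1, inner_smul_left]
    simp

end Hq

/-- The condition `φ - id ∈ H^q(ℝᵈ, ℝᵈ)`. -/
def SubIdMemHq (d : ℕ) (q : ℝ) (φ : Rd d → Rd d) : Prop :=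
  ∃ h : MemLp (fun x => φ x - x) 2 (volume : Measure (Rd d)), h.toLp ∈ sobolevSubmodule d q

/-- The set `𝓓^q(ℝᵈ)` of orientation preserving `C¹`-diffeomorphisms `φ` of `ℝᵈ` with
`φ - id ∈ H^q(ℝᵈ, ℝᵈ)`. -/
def Dq (d : ℕ) (q : ℝ) : Type :=
  {φ : Rd d ≃ₘ^1⟮𝓘(ℝ, Rd d), 𝓘(ℝ, Rd d)⟯ Rd d //
    (∀ x, 0 < (fderiv ℝ φ x).det) ∧ SubIdMemHq d q φ}

namespace Dq

variable {d : ℕ} {q : ℝ}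

/-- The Jacobian determinant `det(dφ(x))`. -/
def jac (φ : Dq d q) (x : Rd d) : ℝ := (fderiv ℝ φ.1 x).det

/-- The global chart `φ ↦ φ - id` with values in `H^q(ℝᵈ, ℝᵈ)`. -/
def chart (d : ℕ) (q : ℝ) (φ : Dq d q) : Hq d q :=
  ⟨MemLp.toLp (fun x => φ.1 x - x) φ.2.2.1, φ.2.2.2⟩

/-- The topology of the Hilbert manifold `𝓓^q(ℝᵈ)`: the one transported from `H^q(ℝᵈ, ℝᵈ)` by the
global chart `φ ↦ φ - id`. -/
@[reducible] def hilbertManifoldTopology (d : ℕ) (q : ℝ) : TopologicalSpace (Dq d q) :=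
  TopologicalSpace.induced (chart d q) inferInstance

/-- `d_q(φ, ψ) = ‖φ - ψ‖_{H^q} + ‖det(dφ)⁻¹ - det(dψ)⁻¹‖_∞`. -/
def distance (φ ψ : Dq d q) : ℝ :=
  ‖chart d q φ - chart d q ψ‖ + ⨆ x : Rd d, |(jac φ x)⁻¹ - (jac ψ x)⁻¹|

end Dq

end SobolevDiffeo

end

noncomputable section

/-! Since `q > d/2 + 1`, the function `(1 + |ξ|²)^((1-q)/2)` is in `L²`. By Cauchy-Schwarz, `𝓕 f`
and `|ξ| 𝓕 f` are integrable with integrals at most `C ‖f‖`. Fourier inversion and Riemann-Lebesgue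
then give `f` a `C¹` representative with `f` and `df` bounded by a multiple of `‖f‖` and `df → 0` at
infinity (`Hq.sobolev_embedding`). So `det(dφ)` tends to `1` at infinity and is bounded below by a
positive constant for each `φ` in `𝓓^q`. Moreover `det(d(id + f))` varies uniformly continuously
with `f` on bounded sets of `H^q`.

The `H^q` term of `d_q` dominates the chart distance. Conversely, near a fixed `φ` the determinants
stay away from `0`, so their inverses are uniformly close, and both topologies agree.

For completeness, the danger is an `H^q` limit `id + f` that is not a diffeomorphism. The
determinant term of `d_q` bounds `det(du_n)⁻¹` along a Cauchy sequence, so the inverses of the `u_n`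
share a Lipschitz constant `K`. Adding a map with Lipschitz constant below `1/K` preserves
bijectivity. This gives a radius independent of `n` around each `u_n`
(`exists_chart_eq_of_norm_sub_lt`), and `f` lies within it for large `n`. The same perturbation
around one `φ` shows that the chart has open image. -/

namespace SobolevDiffeo

open Filter Topology

/-! ### Inverse Fourier integrals of functions with integrable first moment -/

section FourierIntegral

variable {E F : Type*} [NormedAddCommGroup E] [InnerProductSpace ℝ E] [FiniteDimensional ℝ E]
  [MeasurableSpace E] [BorelSpace E]
  [NormedAddCommGroup F] [InnerProductSpace ℂ F]

theorem continuous_fourierInv {f : E → F} (hf : Integrable f) : Continuous (𝓕⁻ f) :=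
  VectorFourier.fourierIntegral_continuous Real.continuous_fourierChar
    (L := -innerₗ E) (continuous_inner (𝕜 := ℝ)).neg hf

/-- The inverse Fourier transform in `L²` of a function in `L¹ ∩ L²` is given by the Fourier
integral. -/
theorem fourierInv_Lp_ae_eq [CompleteSpace F] (h : Lp (α := E) F 2) (hh : Integrable h) :
    (𝓕⁻ h : Lp (α := E) F 2) =ᵐ[volume] 𝓕⁻ (h : E → F) := by
  apply ae_eq_of_integral_contDiff_smul_eq
  · exact (Lp.memLp _).locallyIntegrable (by norm_num)
  · exact (continuous_fourierInv hh).locallyIntegrable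
  intro g hg hgc
  have hg₁ : HasCompactSupport (Complex.ofRealCLM ∘ g) := hgc.comp_left rfl
  have hg₂ : ContDiff ℝ ((⊤ : ℕ∞) : WithTop ℕ∞) (Complex.ofRealCLM ∘ g) := by fun_prop
  set G : SchwartzMap E ℂ := hg₁.toSchwartzMap hg₂ with hG
  have hGa : ∀ x, G x = (g x : ℂ) := fun x => rfl
  -- The distributional definition moves the `L²` inverse transform onto the test function `G`;
  -- Fubini (`h2`) moves it back onto `h` as an integral.
  have h1 := congrArg (fun T : TemperedDistribution E F => T G)
    (Lp.fourierInv_toTemperedDistribution_eq h)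
  simp only [TemperedDistribution.fourierInv_apply, Lp.toTemperedDistribution_apply, hGa] at h1
  have h2 := VectorFourier.integral_fourierIntegral_smul_eq_flip (L := -innerₗ E)
      Real.continuous_fourierChar (continuous_inner (𝕜 := ℝ)).neg
      (G.integrable (μ := volume)) hh
  have hflip : (-innerₗ E).flip = -innerₗ E := by
    ext x y
    simp [real_inner_comm]
  rw [hflip] at h2
  have h3 : ∫ x, (𝓕⁻ G) x • h x = ∫ x, G x • 𝓕⁻ (h : E → F) x := by
    rw [SchwartzMap.fourierInv_coe]; exact h2
  rw [h3] at h1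
  simp only [hGa, Complex.coe_smul] at h1
  exact h1.symm

theorem hasFDerivAt_fourierInv {f : E → F} (hf : Integrable f)
    (hf' : Integrable fun v => ‖v‖ * ‖f v‖) (x : E) :
    HasFDerivAt (𝓕⁻ f) (-𝓕 (VectorFourier.fourierSMulRight (innerSL ℝ) f) (-x)) x := by
  have h1 := (Real.hasFDerivAt_fourier hf hf' (-x)).comp x (hasFDerivAt_id x).neg
  have h2 : (𝓕⁻ f) = (𝓕 f) ∘ fun y => -y := by
    ext y
    exact Real.fourierInv_eq_fourier_neg f y
  rw [h2]
  convert! h1 using 1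
  ext y
  simp

theorem norm_fourierInv_le (f : E → F) (x : E) : ‖𝓕⁻ f x‖ ≤ ∫ v, ‖f v‖ :=
  VectorFourier.norm_fourierIntegral_le_integral_norm _ _ _ _ _

theorem integrable_fourierSMulRight {f : E → F} (hf : Integrable f)
    (hf' : Integrable fun v => ‖v‖ * ‖f v‖) :
    Integrable (VectorFourier.fourierSMulRight (innerSL ℝ) f) := by
  refine (hf'.const_mul (2 * Real.pi * ‖innerSL ℝ (E := E)‖)).mono'
    hf.1.fourierSMulRight (.of_forall fun v => ?_)
  rw [← mul_assoc]
  exact VectorFourier.norm_fourierSMulRight_le _ _ _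

theorem norm_fderiv_fourierInv_le {f : E → F} (hf : Integrable f)
    (hf' : Integrable fun v => ‖v‖ * ‖f v‖) (x : E) :
    ‖fderiv ℝ (𝓕⁻ f) x‖ ≤ 2 * Real.pi * ∫ v, ‖v‖ * ‖f v‖ := by
  rw [(hasFDerivAt_fourierInv hf hf' x).fderiv, norm_neg, ← integral_const_mul]
  refine (VectorFourier.norm_fourierIntegral_le_integral_norm _ _ _ _ _).trans ?_
  refine integral_mono (integrable_fourierSMulRight hf hf').norm (hf'.const_mul _) fun v => ?_
  have h1 := VectorFourier.norm_fourierSMulRight (innerSL ℝ) f v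
  rw [innerSL_apply_norm] at h1
  exact (h1.trans (mul_assoc _ _ _)).le

/-- Riemann-Lebesgue: up to signs, the derivative is the Fourier integral of `fourierSMulRight`. -/
theorem tendsto_fderiv_fourierInv {f : E → F} (hf : Integrable f)
    (hf' : Integrable fun v => ‖v‖ * ‖f v‖) :
    Tendsto (fderiv ℝ (𝓕⁻ f)) (cocompact E) (𝓝 0) := by
  have h1 : fderiv ℝ (𝓕⁻ f) =
      fun x => -𝓕 (VectorFourier.fourierSMulRight (innerSL ℝ) f) (-x) :=
    funext fun x => (hasFDerivAt_fourierInv hf hf' x).fderiv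
  rw [h1, ← neg_zero]
  refine Tendsto.neg ?_
  exact (tendsto_integral_exp_inner_smul_cocompact
    (VectorFourier.fourierSMulRight (innerSL ℝ) f)).comp
    (Homeomorph.neg E).isClosedEmbedding.tendsto_cocompact

theorem contDiff_fourierInv {f : E → F} (hf : Integrable f)
    (hf' : Integrable fun v => ‖v‖ * ‖f v‖) : ContDiff ℝ 1 (𝓕⁻ f) := by
  rw [contDiff_one_iff_fderiv]
  refine ⟨fun x => (hasFDerivAt_fourierInv hf hf' x).differentiableAt, ?_⟩
  have h1 : fderiv ℝ (𝓕⁻ f) =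
      fun x => -𝓕 (VectorFourier.fourierSMulRight (innerSL ℝ) f) (-x) :=
    funext fun x => (hasFDerivAt_fourierInv hf hf' x).fderiv
  rw [h1]
  exact ((VectorFourier.fourierIntegral_continuous Real.continuous_fourierChar
    (L := innerₗ E) continuous_inner (integrable_fourierSMulRight hf hf')).comp
    continuous_neg).neg

omit [InnerProductSpace ℂ F] in
/-- The Cauchy-Schwarz inequality for the integral of a product of norms. -/
theorem integral_mul_norm_le_norm_toLp {k : E → ℝ} (hk : MemLp k 2 (volume : Measure E))
    {g : E → F} (hg : MemLp g 2 (volume : Measure E)) :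
    Integrable (fun v => k v * ‖g v‖) ∧
      ∫ v, k v * ‖g v‖ ≤ ‖hk.toLp‖ * ‖hg.toLp‖ := by
  refine ⟨hk.integrable_mul hg.norm, ?_⟩
  have h1 := real_inner_le_norm hk.toLp hg.norm.toLp
  have h2 : ‖hg.norm.toLp‖ = ‖hg.toLp‖ := by
    rw [Lp.norm_toLp, Lp.norm_toLp, eLpNorm_norm]
  rw [h2, L2.inner_def] at h1
  refine le_trans (le_of_eq ?_) h1
  apply integral_congr_ae
  filter_upwards [hk.coeFn_toLp, hg.norm.coeFn_toLp] with v h3 h4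
  rw [h3, h4]
  simp [mul_comm]

end FourierIntegral

/-! ### Sobolev embedding and completeness of `H^q` -/

variable {d : ℕ} {q : ℝ}

/-- The quotient of `(1 + |ξ|²)^(1/2)` by the weight is square integrable if `q > d/2 + 1`. -/
theorem memLp_rpow_one_sub (hq : (d : ℝ) / 2 + 1 < q) :
    MemLp (fun ξ : Rd d => (1 + ‖ξ‖ ^ 2) ^ ((1 - q) / 2)) 2 volume := by
  have hm : Measurable fun ξ : Rd d => (1 + ‖ξ‖ ^ 2) ^ ((1 - q) / 2) := by fun_prop
  rw [memLp_two_iff_integrable_sq hm.aestronglyMeasurable]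
  -- The squared function is `(1 + ‖ξ‖²)^(-r/2)` with `r = 2(q - 1)`; the integrability condition `d
  -- < r` is the hypothesis on `q`.
  have h := integrable_rpow_neg_one_add_norm_sq (E := Rd d) (μ := volume) (r := 2 * (q - 1))
    (by rw [finrank_euclideanSpace_fin]; linarith)
  refine h.congr (.of_forall fun ξ => ?_)
  dsimp only
  rw [← Real.rpow_natCast ((1 + ‖ξ‖ ^ 2) ^ ((1 - q) / 2)), ← Real.rpow_mul (by positivity)]
  congr 1
  push_cast
  ring

theorem norm_complexify (v : Rd d) : ‖complexify d v‖ = ‖v‖ := by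
  simp [EuclideanSpace.norm_eq, complexify_apply]

/-- Plancherel's theorem for real vector fields. -/
theorem norm_fourierL2 (f : Lp (Rd d) 2 (volume : Measure (Rd d))) : ‖fourierL2 d f‖ = ‖f‖ := by
  have h1 : ‖fourierL2 d f‖ = ‖(complexify d).compLp f‖ := Lp.norm_fourier_eq _
  rw [h1, Lp.norm_def, Lp.norm_def]
  congr 1
  apply eLpNorm_congr_norm_ae
  filter_upwards [(complexify d).coeFn_compLp f] with x hx
  rw [hx, norm_complexify]

theorem one_le_weight (hq : 0 ≤ q) (ξ : Rd d) : 1 ≤ weight d q ξ :=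
  Real.one_le_rpow (by nlinarith [norm_nonneg ξ]) (by positivity)

theorem one_sub_mul_weight (ξ : Rd d) :
    (1 + ‖ξ‖ ^ 2) ^ ((1 - q) / 2) * weight d q ξ = √(1 + ‖ξ‖ ^ 2) := by
  rw [weight, ← Real.rpow_add (by positivity), Real.sqrt_eq_rpow]
  congr 1
  ring

namespace Hq

/-- The `L²` function underlying an element of `H^q`. -/
def toL2 (f : Hq d q) : Lp (Rd d) 2 (volume : Measure (Rd d)) := Subtype.val f

theorem toL2_sub (f g : Hq d q) : (f - g).toL2 = f.toL2 - g.toL2 := rfl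

theorem toL2_injective : Function.Injective (toL2 (d := d) (q := q)) := Subtype.val_injective

theorem weightedFourier_ae (f : Hq d q) :
    weightedFourier d q f =ᵐ[volume] fun ξ => weight d q ξ • fourierL2 d f.toL2 ξ :=
  MemLp.coeFn_toLp (memLp_of_mem_sobolevSubmodule f.2)

/-- Cauchy-Schwarz against `(1 + ‖ξ‖²)^((1-q)/2)` controls the integral of `√(1 + ‖ξ‖²) ‖𝓕 f‖`, and
the square root dominates both `1` and `‖ξ‖`. -/
theorem integrable_fourier (hq : (d : ℝ) / 2 + 1 < q) :
    ∃ C : ℝ, 0 ≤ C ∧ ∀ f : Hq d q,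
      Integrable (fourierL2 d f.toL2) ∧
      Integrable (fun ξ => ‖ξ‖ * ‖fourierL2 d f.toL2 ξ‖) ∧
      ∫ ξ, ‖fourierL2 d f.toL2 ξ‖ ≤ C * ‖f‖ ∧
      ∫ ξ, ‖ξ‖ * ‖fourierL2 d f.toL2 ξ‖ ≤ C * ‖f‖ := by
  have hk := memLp_rpow_one_sub (d := d) hq
  refine ⟨‖hk.toLp‖, norm_nonneg _, fun f => ?_⟩
  have hg := memLp_of_mem_sobolevSubmodule f.2
  obtain ⟨h1, h2⟩ := integral_mul_norm_le_norm_toLp hk hg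
  have h3 : ‖hg.toLp‖ = ‖f‖ := rfl
  rw [h3] at h2
  have h4 : (fun ξ : Rd d => (1 + ‖ξ‖ ^ 2) ^ ((1 - q) / 2) *
      ‖weight d q ξ • fourierL2 d f.toL2 ξ‖) =
      fun ξ => √(1 + ‖ξ‖ ^ 2) * ‖fourierL2 d f.toL2 ξ‖ := by
    ext ξ
    rw [norm_smul, ← mul_assoc, Real.norm_of_nonneg (weight_pos d q ξ).le, one_sub_mul_weight]
  have h5 : Integrable fun ξ => √(1 + ‖ξ‖ ^ 2) * ‖fourierL2 d f.toL2 ξ‖ := h4 ▸ h1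
  have h6 : ∫ ξ, √(1 + ‖ξ‖ ^ 2) * ‖fourierL2 d f.toL2 ξ‖ ≤ ‖hk.toLp‖ * ‖f‖ := by
    rw [← h4]; exact h2
  have ha : ∀ ξ : Rd d, 1 ≤ √(1 + ‖ξ‖ ^ 2) := fun ξ => by
    rw [Real.one_le_sqrt]; nlinarith [norm_nonneg ξ]
  have hb : ∀ ξ : Rd d, ‖ξ‖ ≤ √(1 + ‖ξ‖ ^ 2) := fun ξ => Real.le_sqrt_of_sq_le (by linarith)
  have hm := (Lp.memLp (fourierL2 d f.toL2)).1
  have h7 : Integrable (fourierL2 d f.toL2) := h5.mono' hm (.of_forall fun ξ =>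
    le_mul_of_one_le_left (norm_nonneg _) (ha ξ))
  have h8 : Integrable (fun ξ => ‖ξ‖ * ‖fourierL2 d f.toL2 ξ‖) := by
    refine h5.mono' (continuous_norm.aestronglyMeasurable.mul hm.norm) (.of_forall fun ξ => ?_)
    rw [norm_mul, norm_norm, norm_norm]
    exact mul_le_mul_of_nonneg_right (hb ξ) (norm_nonneg _)
  refine ⟨h7, h8, le_trans (integral_mono h7.norm h5 fun ξ => ?_) h6,
    le_trans (integral_mono h8 h5 fun ξ => ?_) h6⟩
  · exact le_mul_of_one_le_left (norm_nonneg _) (ha ξ)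
  · exact mul_le_mul_of_nonneg_right (hb ξ) (norm_nonneg _)

end Hq

/-- The coordinatewise real part `ℂᵈ → ℝᵈ`. -/
def realPart (d : ℕ) : Cd d →L[ℝ] Rd d :=
  LinearMap.toContinuousLinearMap
    { toFun := fun v => WithLp.toLp 2 (fun i => (v i).re)
      map_add' := by intro v w; ext i; simp
      map_smul' := by intro c v; ext i; simp }

theorem realPart_complexify (v : Rd d) : realPart d (complexify d v) = v := by
  ext i
  exact Complex.ofReal_re _

namespace Hq

/-- The continuous representative of an element of `H^q`. -/
def repr (f : Hq d q) (x : Rd d) : Rd d := realPart d (𝓕⁻ (fourierL2 d f.toL2 : Rd d → Cd d) x)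

/-- The Sobolev embedding `H^q ⊆ C¹₀` for `q > d/2 + 1`. -/
theorem sobolev_embedding (hq : (d : ℝ) / 2 + 1 < q) :
    ∃ C : ℝ, 0 ≤ C ∧ ∀ f : Hq d q,
      f.toL2 =ᵐ[volume] f.repr ∧ ContDiff ℝ 1 f.repr ∧
      (∀ x, ‖f.repr x‖ ≤ C * ‖f‖) ∧ (∀ x, ‖fderiv ℝ f.repr x‖ ≤ C * ‖f‖) ∧
      Tendsto (fderiv ℝ f.repr) (cocompact (Rd d)) (𝓝 0) := by
  obtain ⟨C, hC, h⟩ := integrable_fourier (d := d) hq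
  -- The factor `2π` comes from differentiating the exponential; being at least `1`, it is harmless
  -- in the bound on `f` itself.
  refine ⟨‖realPart d‖ * (2 * Real.pi * C), by positivity, fun f => ?_⟩
  obtain ⟨h1, h2, h3, h4⟩ := h f
  have hc := contDiff_fourierInv h1 h2
  have hfd : fderiv ℝ f.repr = fun x =>
      (realPart d).comp (fderiv ℝ (𝓕⁻ (fourierL2 d f.toL2 : Rd d → Cd d)) x) := by
    ext1 x
    exact ((realPart d).hasFDerivAt.comp x
      (hc.differentiable one_ne_zero x).hasFDerivAt).fderiv
  refine ⟨?_, (realPart d).contDiff.comp hc, fun x => ?_, fun x => ?_, ?_⟩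
  · have h5 := fourierInv_Lp_ae_eq (fourierL2 d f.toL2) h1
    have h6 : 𝓕⁻ (fourierL2 d f.toL2) = (complexify d).compLp f.toL2 :=
      FourierTransform.fourierInv_fourier_eq _
    rw [h6] at h5
    filter_upwards [h5, (complexify d).coeFn_compLp f.toL2] with x hx hx'
    rw [repr, ← hx, hx', realPart_complexify]
  · refine ((realPart d).le_opNorm _).trans ?_
    rw [mul_assoc]
    gcongr
    refine ((norm_fourierInv_le _ x).trans h3).trans ?_
    have := Real.pi_gt_three
    have : 0 ≤ C * ‖f‖ := by positivity
    nlinarith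
  · rw [hfd]
    refine ((realPart d).opNorm_comp_le _).trans ?_
    rw [mul_assoc]
    gcongr
    refine (norm_fderiv_fourierInv_le h1 h2 x).trans ?_
    rw [mul_assoc _ C]
    gcongr
  · rw [hfd]
    have h5 := ((ContinuousLinearMap.compL ℝ (Rd d) (Cd d) (Rd d) (realPart d)).continuous.tendsto
      0).comp (tendsto_fderiv_fourierInv h1 h2)
    rw [map_zero] at h5
    exact h5

theorem norm_toL2_le (hq : 0 ≤ q) (f : Hq d q) : ‖f.toL2‖ ≤ ‖f‖ := by
  rw [← norm_fourierL2, norm_def]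
  apply Lp.norm_le_norm_of_ae_le
  filter_upwards [weightedFourier_ae f] with ξ h
  rw [h, norm_smul, Real.norm_of_nonneg (weight_pos d q ξ).le]
  exact le_mul_of_one_le_left (norm_nonneg _) (one_le_weight hq ξ)

theorem continuous_fourierL2 : Continuous (fourierL2 d) :=
  (AddMonoidHomClass.isometry_of_norm (fourierL2 d) norm_fourierL2).continuous

theorem isometry_weightedFourier : Isometry (weightedFourier d q) :=
  AddMonoidHomClass.isometry_of_norm (weightedFourier d q) fun _ => rfl

/-- As the weight is at least `1`, an `H^q`-Cauchy sequence converges in `L²` to some `f`, while its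
weighted transforms converge to some `G`. It remains to identify `G` with the weighted transform of
`f`. -/
theorem completeSpace (hq : 0 ≤ q) : CompleteSpace (Hq d q) := by
  refine Metric.complete_of_cauchySeq_tendsto fun u hu => ?_
  obtain ⟨G, hG⟩ := cauchySeq_tendsto_of_complete
    (isometry_weightedFourier.uniformContinuous.comp_cauchySeq hu)
  have hu' : CauchySeq fun n => (u n).toL2 := by
    rw [Metric.cauchySeq_iff] at hu ⊢
    intro ε hε
    obtain ⟨N, hN⟩ := hu ε hε
    refine ⟨N, fun m hm n hn => lt_of_le_of_lt ?_ (hN m hm n hn)⟩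
    rw [dist_eq_norm, dist_eq_norm, ← toL2_sub]
    exact norm_toL2_le hq _
  obtain ⟨f, hf⟩ := cauchySeq_tendsto_of_complete hu'
  have hF : Tendsto (fun n => fourierL2 d (u n).toL2) atTop (𝓝 (fourierL2 d f)) :=
    (continuous_fourierL2.tendsto f).comp hf
  have hae : (fun ξ => weight d q ξ • fourierL2 d f ξ) =ᵐ[volume] G := by
    -- The second subsequence is extracted from the first, so both limits hold almost everywhere
    -- along it.
    obtain ⟨ns, hns, h1⟩ :=
      (tendstoInMeasure_of_tendsto_Lp hF).exists_seq_tendsto_ae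
    obtain ⟨ms, hms, h2⟩ :=
      (tendstoInMeasure_of_tendsto_Lp (hG.comp hns.tendsto_atTop)).exists_seq_tendsto_ae
    have h3 : ∀ᵐ ξ, ∀ n, weightedFourier d q (u n) ξ =
        weight d q ξ • fourierL2 d (u n).toL2 ξ :=
      ae_all_iff.mpr fun n => weightedFourier_ae (u n)
    filter_upwards [h1, h2, h3] with ξ h1 h2 h3
    refine tendsto_nhds_unique ?_ h2
    simp only [Function.comp_apply, h3]
    exact (h1.comp hms.tendsto_atTop).const_smul _
  have hmem : f ∈ sobolevSubmodule d q := (memLp_congr_ae hae).mpr (Lp.memLp G)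
  obtain ⟨g, rfl⟩ : ∃ g : Hq d q, g.toL2 = f := ⟨⟨f, hmem⟩, rfl⟩
  have hlim : weightedFourier d q g = G := Lp.ext ((weightedFourier_ae g).trans hae)
  refine ⟨g, ?_⟩
  rw [isometry_weightedFourier.isEmbedding.tendsto_nhds_iff, hlim]
  exact hG

end Hq

/-! ### Lipschitz perturbation of a bijection -/

section Perturbation

variable {E : Type*} [NormedAddCommGroup E]

open scoped NNReal in
/-- A bijection whose inverse is Lipschitz stays one after adding a map with a small Lipschitz
constant. -/
theorem exists_equiv_add_lipschitz [CompleteSpace E] (φ : E ≃ₜ E) {K c : ℝ≥0}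
    (hφ : AntilipschitzWith K φ) {g : E → E} (hg : LipschitzWith c g) (hc : c < K⁻¹) :
    ∃ ψ : E ≃ₜ E, ∀ x, ψ x = φ x + g x := by
  have hanti := hφ.add_lipschitzWith hg hc
  have hK : 0 < K := by
    rw [← inv_pos]
    exact lt_of_le_of_lt zero_le hc
  have hsymm : LipschitzWith K φ.symm := hφ.to_rightInverse φ.apply_symm_apply
  have hsurj : Function.Surjective fun x => φ x + g x := by
    intro y
    -- Solutions of `φ x + g x = y` are the fixed points of this map, a contraction because `K c <
    -- 1`.
    have hcontr : ContractingWith (K * c) fun x => φ.symm (y - g x) := by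
      refine ⟨?_, ?_⟩
      · rwa [← lt_inv_mul_iff₀ hK, mul_one]
      · refine hsymm.comp ?_
        refine LipschitzWith.of_dist_le_mul fun a b => ?_
        rw [dist_sub_left]
        exact hg.dist_le_mul a b
    refine ⟨hcontr.fixedPoint, ?_⟩
    have h1 : φ.symm (y - g hcontr.fixedPoint) = hcontr.fixedPoint := hcontr.fixedPoint_isFixedPt
    have h2 : y - g hcontr.fixedPoint = φ hcontr.fixedPoint := by
      rw [← h1, φ.apply_symm_apply, h1]
    dsimp only
    rw [← h2, sub_add_cancel]
  have hcont : Continuous fun x => φ x + g x := φ.continuous.add hg.continuous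
  let e : E ≃ E := Equiv.ofBijective _ ⟨hanti.injective, hsurj⟩
  have he : LipschitzWith (K⁻¹ - c)⁻¹ e.symm :=
    AntilipschitzWith.to_rightInverse hanti e.apply_symm_apply
  exact ⟨⟨e, hcont, he.continuous⟩, fun x => rfl⟩

end Perturbation

/-! ### Determinants, bounds on inverses, and diffeomorphisms -/

section Det

variable {E : Type*} [NormedAddCommGroup E] [NormedSpace ℝ E] [FiniteDimensional ℝ E]

/-- Left inverses of linear maps of bounded norm with determinant bounded below are uniformly
bounded. -/
theorem exists_norm_leftInverse_le (R : ℝ) {δ : ℝ} (hδ : 0 < δ) :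
    ∃ M : ℝ, 0 < M ∧ ∀ A B : E →L[ℝ] E, ‖A‖ ≤ R → δ ≤ A.det → B * A = 1 → ‖B‖ ≤ M := by
  have : ProperSpace (E →L[ℝ] E) := FiniteDimensional.proper ℝ _
  have : CompleteSpace E := FiniteDimensional.complete ℝ E
  have hunit : ∀ A : E →L[ℝ] E, δ ≤ A.det → IsUnit A := fun A hA => by
    rw [← A.coe_toContinuousLinearEquivOfDetNeZero (hδ.trans_le hA).ne']
    exact ⟨ContinuousLinearEquiv.toUnit _, rfl⟩
  -- This compact set consists of invertible maps, so inversion is continuous, hence bounded, on it.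
  have hS : IsCompact (Metric.closedBall (0 : E →L[ℝ] E) R ∩ {A | δ ≤ A.det}) :=
    (isCompact_closedBall _ _).inter_right
      (isClosed_le continuous_const ContinuousLinearMap.continuous_det)
  have hcont : ContinuousOn (Ring.inverse : (E →L[ℝ] E) → (E →L[ℝ] E))
      (Metric.closedBall (0 : E →L[ℝ] E) R ∩ {A | δ ≤ A.det}) := fun A hA => by
    obtain ⟨u, rfl⟩ := hunit A hA.2
    exact (NormedRing.inverse_continuousAt u).continuousWithinAt
  obtain ⟨M, hM⟩ := hS.exists_bound_of_continuousOn hcont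
  refine ⟨max M 1, by positivity, fun A B hA hdet hBA => le_max_of_le_left ?_⟩
  have h1 : B = Ring.inverse A := by
    rw [← mul_one B, ← Ring.mul_inverse_cancel A (hunit A hdet), ← mul_assoc, hBA, one_mul]
  rw [h1]
  exact hM A ⟨mem_closedBall_zero_iff.mpr hA, hdet⟩

/-- The determinant is uniformly continuous on bounded sets. -/
theorem exists_abs_det_sub_det_lt (R : ℝ) {ε : ℝ} (hε : 0 < ε) :
    ∃ η : ℝ, 0 < η ∧ ∀ A B : E →L[ℝ] E, ‖A‖ ≤ R → ‖B‖ ≤ R → ‖A - B‖ < η →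
      |A.det - B.det| < ε := by
  have : ProperSpace (E →L[ℝ] E) := FiniteDimensional.proper ℝ _
  have huc := (isCompact_closedBall (0 : E →L[ℝ] E) R).uniformContinuousOn_of_continuous
    (ContinuousLinearMap.continuous_det (𝕜 := ℝ) (E := E)).continuousOn
  obtain ⟨η, hη, h⟩ := Metric.uniformContinuousOn_iff.mp huc ε hε
  refine ⟨η, hη, fun A B hA hB hAB => ?_⟩
  rw [← Real.dist_eq]
  exact h A (mem_closedBall_zero_iff.mpr hA) B (mem_closedBall_zero_iff.mpr hB)
    (by rwa [dist_eq_norm])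

open scoped NNReal in
/-- A diffeomorphism with bounded derivative and Jacobian determinant bounded below has a Lipschitz
inverse, with a constant depending only on the bounds. -/
theorem exists_antilipschitzWith (R : ℝ) {δ : ℝ} (hδ : 0 < δ) :
    ∃ K : ℝ≥0, 0 < K ∧ ∀ φ : E ≃ₘ^1⟮𝓘(ℝ, E), 𝓘(ℝ, E)⟯ E,
      (∀ x, ‖fderiv ℝ φ x‖ ≤ R) → (∀ x, δ ≤ (fderiv ℝ φ x).det) → AntilipschitzWith K φ := by
  obtain ⟨M, hM, h⟩ := exists_norm_leftInverse_le (E := E) R hδ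
  refine ⟨⟨M, hM.le⟩, hM, fun φ hφ hdet => ?_⟩
  have h1 : Differentiable ℝ φ := φ.contMDiff.contDiff.differentiable one_ne_zero
  have h2 : Differentiable ℝ φ.symm := φ.symm.contMDiff.contDiff.differentiable one_ne_zero
  have h3 : LipschitzWith ⟨M, hM.le⟩ φ.symm := by
    refine lipschitzWith_of_nnnorm_fderiv_le (𝕜 := ℝ) h2 fun y => ?_
    obtain ⟨x, rfl⟩ := φ.surjective y
    refine h (fderiv ℝ φ x) _ (hφ x) (hdet x) ?_
    -- By the chain rule for `φ⁻¹ ∘ φ = id`, the derivative of the inverse is a left inverse of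
    -- `dφ`.
    have h4 := ((h2 (φ x)).hasFDerivAt.comp x (h1 x).hasFDerivAt)
    have h5 : φ.symm ∘ φ = id := funext φ.symm_apply_apply
    rw [h5] at h4
    exact h4.unique (hasFDerivAt_id x)
  exact h3.to_rightInverse φ.symm_apply_apply

/-- A `C¹` homeomorphism with nonvanishing Jacobian determinant is a diffeomorphism. -/
def diffeomorphOfDetNeZero (ψ : E ≃ₜ E) (hψ : ContDiff ℝ 1 ψ)
    (hdet : ∀ x, (fderiv ℝ ψ x).det ≠ 0) : E ≃ₘ^1⟮𝓘(ℝ, E), 𝓘(ℝ, E)⟯ E where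
  toEquiv := ψ.toEquiv
  contMDiff_toFun := hψ.contMDiff
  contMDiff_invFun := by
    have : CompleteSpace E := FiniteDimensional.complete ℝ E
    refine ContDiff.contMDiff (ψ.contDiff_symm
      (f₀' := fun x => (fderiv ℝ ψ x).toContinuousLinearEquivOfDetNeZero (hdet x)) (fun x => ?_) hψ)
    rw [ContinuousLinearMap.coe_toContinuousLinearEquivOfDetNeZero]
    exact (hψ.differentiable one_ne_zero x).hasFDerivAt

end Det

/-! ### The maps `id + f` and their Jacobians -/

namespace Hq

theorem ae_eq_repr (hq : (d : ℝ) / 2 + 1 < q) (f : Hq d q) : f.toL2 =ᵐ[volume] f.repr := by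
  obtain ⟨C, -, h⟩ := sobolev_embedding (d := d) hq
  exact (h f).1

theorem contDiff_repr (hq : (d : ℝ) / 2 + 1 < q) (f : Hq d q) : ContDiff ℝ 1 f.repr := by
  obtain ⟨C, -, h⟩ := sobolev_embedding (d := d) hq
  exact (h f).2.1

theorem repr_eq_of_ae_eq (hq : (d : ℝ) / 2 + 1 < q) (f : Hq d q) {u : Rd d → Rd d}
    (hu : Continuous u) (h : f.toL2 =ᵐ[volume] u) : f.repr = u :=
  Measure.eq_of_ae_eq ((ae_eq_repr hq f).symm.trans h) (contDiff_repr hq f).continuous hu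

theorem repr_sub (hq : (d : ℝ) / 2 + 1 < q) (f g : Hq d q) :
    (f - g).repr = fun x => f.repr x - g.repr x := by
  refine repr_eq_of_ae_eq hq _
    ((contDiff_repr hq f).continuous.sub (contDiff_repr hq g).continuous) ?_
  rw [toL2_sub]
  filter_upwards [Lp.coeFn_sub f.toL2 g.toL2, ae_eq_repr hq f, ae_eq_repr hq g] with x h1 h2 h3
  rw [h1, Pi.sub_apply, h2, h3]

/-- The map `id + f` for `f ∈ H^q`. -/
def idAdd (f : Hq d q) (x : Rd d) : Rd d := x + f.repr x

theorem contDiff_idAdd (hq : (d : ℝ) / 2 + 1 < q) (f : Hq d q) : ContDiff ℝ 1 f.idAdd :=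
  contDiff_id.add (contDiff_repr hq f)

theorem differentiable_repr (hq : (d : ℝ) / 2 + 1 < q) (f : Hq d q) : Differentiable ℝ f.repr :=
  (contDiff_repr hq f).differentiable one_ne_zero

theorem fderiv_idAdd (hq : (d : ℝ) / 2 + 1 < q) (f : Hq d q) (x : Rd d) :
    fderiv ℝ f.idAdd x = 1 + fderiv ℝ f.repr x :=
  ((hasFDerivAt_id x).add (differentiable_repr hq f x).hasFDerivAt).fderiv

theorem fderiv_repr_sub (hq : (d : ℝ) / 2 + 1 < q) (f g : Hq d q) (x : Rd d) :
    fderiv ℝ (f - g).repr x = fderiv ℝ f.idAdd x - fderiv ℝ g.idAdd x := by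
  rw [repr_sub hq, fderiv_idAdd hq, fderiv_idAdd hq, add_sub_add_left_eq_sub]
  exact fderiv_fun_sub (differentiable_repr hq f x) (differentiable_repr hq g x)

theorem exists_norm_fderiv_idAdd_le (hq : (d : ℝ) / 2 + 1 < q) (R : ℝ) :
    ∃ M : ℝ, ∀ f : Hq d q, ‖f‖ ≤ R → ∀ x, ‖fderiv ℝ f.idAdd x‖ ≤ M := by
  obtain ⟨C, hC, h⟩ := sobolev_embedding (d := d) hq
  refine ⟨‖(1 : Rd d →L[ℝ] Rd d)‖ + C * R, fun f hf x => ?_⟩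
  rw [fderiv_idAdd hq]
  refine (norm_add_le _ _).trans ?_
  gcongr
  exact ((h f).2.2.2.1 x).trans (by gcongr)

/-- On bounded subsets of `H^q` the Jacobian determinant of `id + f` depends uniformly continuously
on `f`, in the supremum norm. -/
theorem exists_abs_det_sub_lt (hq : (d : ℝ) / 2 + 1 < q) (R : ℝ) {ε : ℝ} (hε : 0 < ε) :
    ∃ ρ : ℝ, 0 < ρ ∧ ∀ f g : Hq d q, ‖f‖ ≤ R → ‖f - g‖ < ρ → ∀ x,
      |(fderiv ℝ f.idAdd x).det - (fderiv ℝ g.idAdd x).det| < ε := by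
  obtain ⟨C, hC, h⟩ := sobolev_embedding (d := d) hq
  obtain ⟨M, hM⟩ := exists_norm_fderiv_idAdd_le (d := d) hq (R + 1)
  obtain ⟨η, hη, hdet⟩ := exists_abs_det_sub_det_lt (E := Rd d) M hε
  -- The `1` keeps `g` in the ball of radius `R + 1` where `M` applies; dividing by `C + 1` avoids
  -- the case `C = 0`.
  refine ⟨min 1 (η / (C + 1)), by positivity, fun f g hf hfg x => ?_⟩
  have hg : ‖g‖ ≤ R + 1 := by
    have h1 := norm_sub_norm_le g f
    rw [norm_sub_rev] at h1
    have h2 := hfg.trans_le (min_le_left _ _)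
    linarith
  refine hdet _ _ (hM f (by linarith) x) (hM g hg x) ?_
  rw [← fderiv_repr_sub hq]
  refine ((h (f - g)).2.2.2.1 x).trans_lt ?_
  have h3 := hfg.trans_le (min_le_right _ _)
  rw [lt_div_iff₀ (by positivity)] at h3
  nlinarith [norm_nonneg (f - g)]

end Hq

/-! ### The chart, the metric `d_q` and its completeness -/

namespace Dq

theorem continuous_coe (φ : Dq d q) : Continuous φ.1 := φ.1.contMDiff.contDiff.continuous

theorem repr_chart (hq : (d : ℝ) / 2 + 1 < q) (φ : Dq d q) :
    (chart d q φ).repr = fun x => φ.1 x - x :=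
  Hq.repr_eq_of_ae_eq hq _ (φ.continuous_coe.sub continuous_id)
    (MemLp.coeFn_toLp φ.2.2.1)

theorem idAdd_chart (hq : (d : ℝ) / 2 + 1 < q) (φ : Dq d q) : (chart d q φ).idAdd = φ.1 := by
  ext1 x
  rw [Hq.idAdd, repr_chart hq, add_sub_cancel]

theorem chart_injective (hq : (d : ℝ) / 2 + 1 < q) : Function.Injective (chart d q) := by
  intro φ ψ h
  apply Subtype.ext
  apply Diffeomorph.ext
  intro x
  rw [← idAdd_chart hq, ← idAdd_chart hq, h]

theorem jac_eq (hq : (d : ℝ) / 2 + 1 < q) (φ : Dq d q) (x : Rd d) :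
    φ.jac x = (fderiv ℝ (chart d q φ).idAdd x).det := by
  rw [idAdd_chart hq, jac]

theorem jac_pos (φ : Dq d q) (x : Rd d) : 0 < φ.jac x := φ.2.1 x

/-- The Jacobian determinant is bounded below by a positive constant. -/
theorem exists_le_jac (hq : (d : ℝ) / 2 + 1 < q) (φ : Dq d q) :
    ∃ δ : ℝ, 0 < δ ∧ ∀ x, δ ≤ φ.jac x := by
  obtain ⟨C, hC, h⟩ := Hq.sobolev_embedding (d := d) hq
  -- As `dφ → 1` at infinity, the Jacobian is at least `1/2` off a compact set, on which it attains
  -- a positive minimum.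
  have hlim : Tendsto φ.jac (cocompact (Rd d)) (𝓝 1) := by
    have h1 := ((ContinuousLinearMap.continuous_det (𝕜 := ℝ) (E := Rd d)).tendsto _).comp
      ((h (chart d q φ)).2.2.2.2.const_add 1)
    have h2 : (1 + 0 : Rd d →L[ℝ] Rd d).det = 1 := by
      rw [add_zero]
      exact LinearMap.det_id
    rw [h2] at h1
    refine h1.congr fun x => ?_
    rw [jac_eq hq, Hq.fderiv_idAdd hq]
    rfl
  have hcont : Continuous φ.jac :=
    ContinuousLinearMap.continuous_det.comp
      (φ.1.contMDiff.contDiff.continuous_fderiv one_ne_zero)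
  obtain ⟨K, hK, hKc⟩ := mem_cocompact.mp (hlim (Ici_mem_nhds one_half_lt_one))
  rcases K.eq_empty_or_nonempty with rfl | hne
  · exact ⟨1 / 2, by norm_num, fun x => hKc (by simp)⟩
  obtain ⟨y, -, hy⟩ := hK.exists_isMinOn hne hcont.continuousOn
  refine ⟨min (1 / 2) (φ.jac y), lt_min (by norm_num) (φ.jac_pos y), fun x => ?_⟩
  by_cases hx : x ∈ K
  · exact (min_le_right _ _).trans (hy hx)
  · exact (min_le_left _ _).trans (hKc hx)

/-- A homeomorphism `id + f` with `f ∈ H^q` and positive Jacobian determinant belongs to `𝓓^q`. -/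
theorem exists_chart_eq_of_homeomorph (hq : (d : ℝ) / 2 + 1 < q) (f : Hq d q)
    (Ψ : Rd d ≃ₜ Rd d) (hΨ : ⇑Ψ = f.idAdd) (hdet : ∀ x, 0 < (fderiv ℝ f.idAdd x).det) :
    ∃ ψ : Dq d q, chart d q ψ = f := by
  have hC : ContDiff ℝ 1 Ψ := hΨ ▸ Hq.contDiff_idAdd hq f
  have hdet' : ∀ x, 0 < (fderiv ℝ Ψ x).det := hΨ ▸ hdet
  have hae : f.toL2 =ᵐ[volume] fun x => Ψ x - x := by
    filter_upwards [Hq.ae_eq_repr hq f] with x hx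
    rw [hx, hΨ, Hq.idAdd, add_sub_cancel_left]
  have hmem : MemLp (fun x => Ψ x - x) 2 (volume : Measure (Rd d)) :=
    (memLp_congr_ae hae).mp (Lp.memLp f.toL2)
  have hL : hmem.toLp = f.toL2 := Lp.ext (hmem.coeFn_toLp.trans hae.symm)
  refine ⟨⟨diffeomorphOfDetNeZero Ψ hC fun x => (hdet' x).ne', hdet', hmem, ?_⟩, ?_⟩
  · exact hL ▸ f.2
  · exact Hq.toL2_injective hL

/-- Maps `id + f` with positive Jacobian determinant belong to `𝓓^q` if `f` is close enough to the
image of an element of `𝓓^q`, uniformly under bounds on norm and Jacobian determinant. -/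
theorem exists_chart_eq_of_norm_sub_lt (hq : (d : ℝ) / 2 + 1 < q) (R : ℝ) {δ : ℝ} (hδ : 0 < δ) :
    ∃ ρ : ℝ, 0 < ρ ∧ ∀ (φ : Dq d q) (f : Hq d q), ‖chart d q φ‖ ≤ R → (∀ x, δ ≤ φ.jac x) →
      ‖f - chart d q φ‖ < ρ → (∀ x, 0 < (fderiv ℝ f.idAdd x).det) →
      ∃ ψ : Dq d q, chart d q ψ = f := by
  obtain ⟨C, hC, h⟩ := Hq.sobolev_embedding (d := d) hq
  obtain ⟨M, hM⟩ := Hq.exists_norm_fderiv_idAdd_le (d := d) hq R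
  obtain ⟨K, hK, hanti⟩ := exists_antilipschitzWith (E := Rd d) M hδ
  have hK' : (0 : ℝ) < K := hK
  -- This radius makes the Lipschitz constant `C ‖f - chart φ‖` of the perturbation smaller than
  -- `K⁻¹`; it depends on `φ` only through `R` and `δ`.
  refine ⟨(K : ℝ)⁻¹ / (C + 1), by positivity, fun φ f hφ hjac hf hdet => ?_⟩
  have hφK : AntilipschitzWith K φ.1 :=
    hanti φ.1 (fun x => by rw [← idAdd_chart hq]; exact hM _ hφ x) hjac
  have hlip : LipschitzWith (C * ‖f - chart d q φ‖).toNNReal (f - chart d q φ).repr := by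
    refine lipschitzWith_of_nnnorm_fderiv_le (𝕜 := ℝ) (Hq.differentiable_repr hq _) fun x => ?_
    rw [← NNReal.coe_le_coe, Real.coe_toNNReal _ (by positivity)]
    exact (h _).2.2.2.1 x
  have hlt : (C * ‖f - chart d q φ‖).toNNReal < K⁻¹ := by
    rw [← NNReal.coe_lt_coe, Real.coe_toNNReal _ (by positivity), NNReal.coe_inv]
    rw [lt_div_iff₀ (by positivity)] at hf
    nlinarith [norm_nonneg (f - chart d q φ)]
  obtain ⟨Ψ, hΨ⟩ := exists_equiv_add_lipschitz φ.1.toHomeomorph hφK hlip hlt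
  refine exists_chart_eq_of_homeomorph hq f Ψ (funext fun x => ?_) hdet
  rw [hΨ, Hq.repr_sub hq, repr_chart hq, Hq.idAdd, Diffeomorph.coe_toHomeomorph]
  dsimp only
  abel

/-- Near `φ` the Jacobian changes by less than its lower bound `δ`, so it stays positive and the
perturbation result applies. -/
theorem isOpen_range_chart (hq : (d : ℝ) / 2 + 1 < q) : IsOpen (Set.range (chart d q)) := by
  rw [Metric.isOpen_iff]
  rintro _ ⟨φ, rfl⟩
  obtain ⟨δ, hδ, hjac⟩ := exists_le_jac hq φ
  obtain ⟨ρ₁, hρ₁, h1⟩ := exists_chart_eq_of_norm_sub_lt (d := d) hq ‖chart d q φ‖ hδ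
  obtain ⟨ρ₂, hρ₂, h2⟩ := Hq.exists_abs_det_sub_lt (d := d) hq ‖chart d q φ‖ hδ
  refine ⟨min ρ₁ ρ₂, lt_min hρ₁ hρ₂, fun f hf => ?_⟩
  rw [Metric.mem_ball, dist_eq_norm, lt_min_iff] at hf
  refine h1 φ f le_rfl hjac hf.1 fun x => ?_
  have h3 := h2 (chart d q φ) f le_rfl (by rw [norm_sub_rev]; exact hf.2) x
  rw [← jac_eq hq] at h3
  linarith [(abs_lt.mp h3).2, hjac x]

theorem bddAbove_range_abs_inv_jac_sub (hq : (d : ℝ) / 2 + 1 < q) (φ ψ : Dq d q) :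
    BddAbove (Set.range fun x : Rd d => |(φ.jac x)⁻¹ - (ψ.jac x)⁻¹|) := by
  obtain ⟨δ, hδ, h1⟩ := exists_le_jac hq φ
  obtain ⟨η, hη, h2⟩ := exists_le_jac hq ψ
  refine ⟨δ⁻¹ + η⁻¹, ?_⟩
  rintro _ ⟨x, rfl⟩
  have h3 := inv_anti₀ hδ (h1 x)
  have h4 := inv_anti₀ hη (h2 x)
  have h5 := inv_pos.mpr (φ.jac_pos x)
  have h6 := inv_pos.mpr (ψ.jac_pos x)
  exact abs_le.mpr ⟨by linarith, by linarith⟩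

theorem abs_inv_jac_sub_le (hq : (d : ℝ) / 2 + 1 < q) (φ ψ : Dq d q) (x : Rd d) :
    |(φ.jac x)⁻¹ - (ψ.jac x)⁻¹| ≤ ⨆ x : Rd d, |(φ.jac x)⁻¹ - (ψ.jac x)⁻¹| :=
  le_ciSup (bddAbove_range_abs_inv_jac_sub hq φ ψ) x

theorem norm_chart_sub_le_distance (φ ψ : Dq d q) :
    ‖chart d q φ - chart d q ψ‖ ≤ distance φ ψ :=
  le_add_of_nonneg_right (Real.iSup_nonneg fun _ => abs_nonneg _)

theorem abs_inv_jac_sub_le_distance (hq : (d : ℝ) / 2 + 1 < q) (φ ψ : Dq d q) (x : Rd d) :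
    |(φ.jac x)⁻¹ - (ψ.jac x)⁻¹| ≤ distance φ ψ :=
  (abs_inv_jac_sub_le hq φ ψ x).trans (le_add_of_nonneg_left (norm_nonneg _))

/-- The distance `d_q` is continuous for the topology of the chart. -/
theorem exists_distance_lt (hq : (d : ℝ) / 2 + 1 < q) (φ : Dq d q) {ε : ℝ} (hε : 0 < ε) :
    ∃ ρ : ℝ, 0 < ρ ∧ ∀ ψ : Dq d q, ‖chart d q φ - chart d q ψ‖ < ρ → distance φ ψ < ε := by
  obtain ⟨δ, hδ, hjac⟩ := exists_le_jac hq φ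
  obtain ⟨ρ, hρ, h⟩ := Hq.exists_abs_det_sub_lt (d := d) hq ‖chart d q φ‖
    -- The first entry keeps the Jacobian of `ψ` above `δ/2`; the second then gives `|a⁻¹ - b⁻¹| =
    -- |a - b| / (ab) ≤ ε/3`. Thirds are used because the supremum only inherits a non-strict bound.
    (ε := min (δ / 2) (ε / 3 * (δ * (δ / 2)))) (by positivity)
  refine ⟨min ρ (ε / 3), by positivity, fun ψ hψ => ?_⟩
  rw [lt_min_iff] at hψ
  have h1 : ∀ x, |(φ.jac x)⁻¹ - (ψ.jac x)⁻¹| ≤ ε / 3 := fun x => by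
    have h2 := h (chart d q φ) (chart d q ψ) le_rfl hψ.1 x
    rw [← jac_eq hq, ← jac_eq hq, lt_min_iff] at h2
    have h3 := hjac x
    have h4 : δ / 2 ≤ ψ.jac x := by linarith [(abs_lt.mp h2.1).2]
    rw [inv_sub_inv (φ.jac_pos x).ne' (ψ.jac_pos x).ne', abs_div, abs_sub_comm,
      abs_of_pos (mul_pos (φ.jac_pos x) (ψ.jac_pos x)),
      div_le_iff₀ (mul_pos (φ.jac_pos x) (ψ.jac_pos x))]
    refine h2.2.le.trans ?_
    have h5 := (φ.jac_pos x).le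
    gcongr
  have h5 : (⨆ x : Rd d, |(φ.jac x)⁻¹ - (ψ.jac x)⁻¹|) ≤ ε / 3 := ciSup_le h1
  rw [distance]
  linarith [hψ.2]

/-- The metric space structure on `𝓓^q` given by `d_q`. -/
@[reducible] def metricSpace (hq : (d : ℝ) / 2 + 1 < q) : MetricSpace (Dq d q) where
  dist := distance
  dist_self φ := by simp [distance]
  dist_comm φ ψ := by
    simp only [distance, norm_sub_rev (chart d q φ), abs_sub_comm (φ.jac _)⁻¹]
  dist_triangle φ ψ χ := by
    have h1 := norm_sub_le_norm_sub_add_norm_sub (chart d q φ) (chart d q ψ) (chart d q χ)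
    have h2 : (⨆ x : Rd d, |(φ.jac x)⁻¹ - (χ.jac x)⁻¹|) ≤
        (⨆ x : Rd d, |(φ.jac x)⁻¹ - (ψ.jac x)⁻¹|) + ⨆ x : Rd d, |(ψ.jac x)⁻¹ - (χ.jac x)⁻¹| :=
      ciSup_le fun x => (abs_sub_le _ (ψ.jac x)⁻¹ _).trans
        (add_le_add (abs_inv_jac_sub_le hq φ ψ x) (abs_inv_jac_sub_le hq ψ χ x))
    simp only [distance]
    linarith
  eq_of_dist_eq_zero {φ ψ} h := by
    apply chart_injective hq
    rw [← sub_eq_zero, ← norm_le_zero_iff]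
    exact (norm_chart_sub_le_distance φ ψ).trans h.le

theorem isInducing_chart (hq : (d : ℝ) / 2 + 1 < q) :
    @Topology.IsInducing _ _ (metricSpace hq).toUniformSpace.toTopologicalSpace _ (chart d q) := by
  let := metricSpace (d := d) hq
  rw [isInducing_iff_nhds]
  intro φ
  refine le_antisymm ?_ ?_
  · rw [← map_le_iff_le_comap]
    change Tendsto (chart d q) (𝓝 φ) (𝓝 (chart d q φ))
    rw [Metric.tendsto_nhds_nhds]
    refine fun ε hε => ⟨ε, hε, fun {ψ} h => ?_⟩
    rw [dist_eq_norm]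
    exact (norm_chart_sub_le_distance ψ φ).trans_lt h
  · intro s hs
    obtain ⟨ε, hε, hs⟩ := Metric.mem_nhds_iff.mp hs
    obtain ⟨ρ, hρ, h⟩ := exists_distance_lt hq φ hε
    refine ⟨Metric.ball (chart d q φ) ρ, Metric.ball_mem_nhds _ hρ, fun ψ hψ => hs ?_⟩
    rw [Metric.mem_ball, dist_comm]
    refine h ψ ?_
    rw [norm_sub_rev, ← dist_eq_norm]
    exact hψ

/-- The determinant term of `d_q` keeps the Jacobians of a Cauchy sequence uniformly away from `0`,
which forces the `H^q` limit into the image of the chart. -/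
theorem completeSpace (hq : (d : ℝ) / 2 + 1 < q) :
    @CompleteSpace (Dq d q) (metricSpace hq).toUniformSpace := by
  let := metricSpace (d := d) hq
  have hq0 : 0 ≤ q := by
    have : (0 : ℝ) ≤ d := Nat.cast_nonneg d
    linarith
  have := Hq.completeSpace (d := d) hq0
  refine Metric.complete_of_cauchySeq_tendsto fun u hu => ?_
  have hu' : CauchySeq fun n => chart d q (u n) := by
    rw [Metric.cauchySeq_iff] at hu ⊢
    intro ε hε
    obtain ⟨N, hN⟩ := hu ε hε
    refine ⟨N, fun m hm n hn => lt_of_le_of_lt ?_ (hN m hm n hn)⟩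
    rw [dist_eq_norm]
    exact norm_chart_sub_le_distance _ _
  obtain ⟨f, hf⟩ := cauchySeq_tendsto_of_complete hu'
  obtain ⟨N, hN⟩ := Metric.cauchySeq_iff'.mp hu 1 one_pos
  obtain ⟨δ, hδ, hjac⟩ := exists_le_jac hq (u N)
  -- The inverse Jacobian of `u N` is at most `δ⁻¹`, and that of `u n` differs from it by at most
  -- `1`.
  have hlow : ∀ n ≥ N, ∀ x, (δ⁻¹ + 1)⁻¹ ≤ (u n).jac x := fun n hn x => by
    have h1 := (abs_inv_jac_sub_le_distance hq (u n) (u N) x).trans (hN n hn).le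
    have h2 := inv_anti₀ hδ (hjac x)
    rw [inv_le_comm₀ (by positivity) ((u n).jac_pos x)]
    linarith [(abs_le.mp h1).2]
  have hη : 0 < (δ⁻¹ + 1)⁻¹ := by positivity
  -- Both radii are fixed before `n`, since they depend only on `f` and the common Jacobian bound;
  -- one sufficiently late `u n` then serves as the base point.
  obtain ⟨ρ₁, hρ₁, h1⟩ := exists_chart_eq_of_norm_sub_lt (d := d) hq (‖f‖ + 1) hη
  obtain ⟨ρ₂, hρ₂, h2⟩ := Hq.exists_abs_det_sub_lt (d := d) hq ‖f‖ hη
  have hρ : 0 < min 1 (min ρ₁ ρ₂) := by positivity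
  obtain ⟨n, hn, hnf⟩ := ((eventually_ge_atTop N).and
    (Metric.tendsto_nhds.mp hf _ hρ)).exists
  rw [dist_comm, dist_eq_norm, lt_min_iff, lt_min_iff] at hnf
  obtain ⟨ψ, hψ⟩ := h1 (u n) f (by
      have := norm_sub_norm_le (chart d q (u n)) f
      rw [norm_sub_rev] at this
      linarith [hnf.1]) (hlow n hn) hnf.2.1 fun x => by
    have h3 := h2 f (chart d q (u n)) le_rfl hnf.2.2 x
    rw [← jac_eq hq] at h3
    linarith [(abs_lt.mp h3).1, hlow n hn x]
  refine ⟨ψ, ?_⟩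
  rw [(isInducing_chart hq).tendsto_nhds_iff, hψ]
  exact hf

end Dq

end SobolevDiffeo
end

theorem mainTheorem11 (d : ℕ) (q : ℝ) (hq : (d : ℝ) / 2 + 1 < q) :
    -- the supremum in the definition of the distance is finite
    (∀ φ ψ : SobolevDiffeo.Dq d q,
      BddAbove (Set.range fun x : SobolevDiffeo.Rd d => |(φ.jac x)⁻¹ - (ψ.jac x)⁻¹|)) ∧
    -- `φ ↦ φ - id` is a homeomorphism onto an open subset of `H^q`, hence a global chart
    @Topology.IsOpenEmbedding _ _ (SobolevDiffeo.Dq.hilbertManifoldTopology d q) _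
      (SobolevDiffeo.Dq.chart d q) ∧
    ∃ m : MetricSpace (SobolevDiffeo.Dq d q),
      (∀ φ ψ : SobolevDiffeo.Dq d q, m.dist φ ψ = SobolevDiffeo.Dq.distance φ ψ) ∧
      @CompleteSpace (SobolevDiffeo.Dq d q) m.toUniformSpace ∧
      m.toUniformSpace.toTopologicalSpace =
        SobolevDiffeo.Dq.hilbertManifoldTopology d q := by
  refine ⟨SobolevDiffeo.Dq.bddAbove_range_abs_inv_jac_sub hq, ?_,
    SobolevDiffeo.Dq.metricSpace hq, fun _ _ => rfl, SobolevDiffeo.Dq.completeSpace hq,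
    @Topology.IsInducing.eq_induced _ _ (_) _ _ (SobolevDiffeo.Dq.isInducing_chart hq)⟩
  let := SobolevDiffeo.Dq.hilbertManifoldTopology d q
  exact ⟨⟨⟨rfl⟩, SobolevDiffeo.Dq.chart_injective hq⟩, SobolevDiffeo.Dq.isOpen_range_chart hq⟩
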